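/- Setting. Let $\mathcal H\neq\emptyset$ be a set of hypotheses $h:X\to\{0,1\}$, let $x_1,\dots,x_m\in X$ be training examples with labels $y_1,\dots,y_m\in\{0,1\}$, and let $M\subseteq\{0,1\}^m$ be the set of error rows $\eta$ of the hypotheses: $\eta(i)=\mathbf 1[h(x_i)\ne y_i]$, $h\in\mathcal H$. Let $\Delta_m=\{w\in\mathbb R^m: w(i)\ge 0,\ \sum_i w(i)=1\}$ and $\eta\cdot w=\sum_i\eta(i)w(i)$. Let $\mathrm{AdaSelect}$ pick an element of each nonempty subset of $M$, and for $w\in\Delta_m$ put $$\eta^w=\mathrm{AdaSelect}\Big(\operatorname*{argmin}_{\eta\in M}\eta\cdot w\Big),\quad \epsilon(w)=\min_{\eta\in M}\eta\cdot w,\quad \alpha(w)=\tfrac12\log\frac{1-\epsilon(w)}{\epsilon(w)},\quad \sigma(\eta)=\Big\{w\in\Delta_m:\eta\in\operatorname*{argmin}_{\eta'\in M}\eta'\cdot w\Big\}.$$ The update of Optimal AdaBoost is defined at the $w\in\Delta_m$ with $0<\epsilon(w)<1$ by $$\mathcal A(w)(i)=\tfrac12\,w(i)\Big(\frac1{\eta\cdot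 w}\Big)^{\eta(i)}\Big(\frac1{1-\eta\cdot w}\Big)^{1-\eta(i)},\qquad \eta=\eta^w .$$ Let $\mathcal A^{(t)}(\Delta_m)$ be the set of weights reached from $\Delta_m$ by $t$ defined updates, and $\Omega_\infty=\bigcap_{t\ge1}\mathcal A^{(t)}(\Delta_m)$. A Borel probability measure $\mu$ on $\Delta_m$ is called invariant if $\mathcal A$ is defined $\mu$-almost everywhere and preserves $\mu$. Assumption (No Ties). There is a compact set $G\subseteq\Delta_m$ with $\Omega_\infty\subseteq G$ such that for all $\eta,\eta'\in M$ either $\sigma(\eta)\cap\sigma(\eta')\cap G=\emptyset$, or $\sum_{i:\eta(i)\ne\eta'(i)}w(i)=0$ for all $w\in G$. Theorem. Suppose that the No Ties assumption holds. (a) If $\Omega_\infty\ne\emptyset$, then an invariant Borel probability measure on $\Delta_m$ exists. (b) Let $\mu$ be any invariant Borel probability measure on $\Delta_m$. For $\mu$-almost every starting weight $w_1$ the following holds, with $w_t=\mathcal A^{t-1}(w_1)$, $\alpha_t=\alpha(w_t)$, $\eta_t=\eta^{w_t}$: for every training example $x_i$ the limit $$\lim_{T\to\infty}\frac1T F_T(x_i),\qquad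 F_T(x_i)=\sum_{t=1}^T 2\alpha_t(\eta_t(i)-1),$$ exists in $\mathbb R$; and, for any hypotheses $h_t\in\mathcal H$ whose error rows are $\eta_t$, taken with predictions in $\{-1,1\}$, the limit $\lim_{T\to\infty}\frac1T\sum_{t=1}^T\alpha_t h_t(x_i)$ exists in $\mathbb R$. -/

import Mathlib

open MeasureTheory Filter Topology

noncomputable section

namespace AdaBoost

variable {X : Type*} {m : ℕ}

/-- The standard simplex of weights over `m` training examples. -/
abbrev Simplex (m : ℕ) : Type := stdSimplex ℝ (Fin m)

/-- A 0-1 row (`true` is 1, `false` is 0). -/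
abbrev Row (m : ℕ) : Type := Fin m → Bool

/-- The entry `η(i)` as a real number, 0 or 1. -/
def entry (η : Row m) (i : Fin m) : ℝ := ((η i).toNat : ℝ)

/-- The error row of a hypothesis on the labelled sample: 1 exactly where it is incorrect. -/
def errorRow (x : Fin m → X) (y : Fin m → Bool) (h : X → Bool) : Row m :=
  fun i => decide (h (x i) ≠ y i)

/-- The error matrix, as the set of its rows. -/
def errorMatrix (H : Set (X → Bool)) (x : Fin m → X) (y : Fin m → Bool) : Set (Row m) :=
  errorRow x y '' H

/-- The weighted error `η · w`. -/
def err (η : Row m) (w : Simplex m) : ℝ := ∑ i, entry η i * w.1 i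

/-- The rows of least weighted error. -/
def argminRows (M : Set (Row m)) (w : Simplex m) : Set (Row m) :=
  {η | η ∈ M ∧ ∀ η' ∈ M, err η w ≤ err η' w}

/-- The row selected at `w`, ties being broken by `sel`. -/
def best (M : Set (Row m)) (sel : Set (Row m) → Row m) (w : Simplex m) : Row m :=
  sel (argminRows M w)

/-- The weights at which `η` is optimal (possibly tied). -/
def sigma (M : Set (Row m)) (η : Row m) : Set (Simplex m) := {w | η ∈ argminRows M w}

/-- The hypothetical update `T_η`, componentwise. -/
def updateVec (η : Row m) (w : Simplex m) : Fin m → ℝ := fun i =>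
  1 / 2 * w.1 i * (1 / err η w) ^ (η i).toNat * (1 / (1 - err η w)) ^ (1 - (η i).toNat)

theorem updateVec_mem (η : Row m) (w : Simplex m) (h0 : 0 < err η w) (h1 : err η w < 1) :
    updateVec η w ∈ stdSimplex ℝ (Fin m) := by
  have h1' : 0 < 1 - err η w := by linarith
  refine ⟨fun i => ?_, ?_⟩
  · have := w.2.1 i
    unfold updateVec
    positivity
  · have hsum : ∑ i, w.1 i = 1 := w.2.2
    have key : ∀ i, updateVec η w i =
        1 / 2 * (1 / err η w) * (entry η i * w.1 i) +
        1 / 2 * (1 / (1 - err η w)) * (w.1 i - entry η i * w.1 i) := by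
      intro i
      unfold updateVec entry
      cases η i <;> simp <;> ring
    simp_rw [key]
    rw [Finset.sum_add_distrib, ← Finset.mul_sum, ← Finset.mul_sum, Finset.sum_sub_distrib, hsum]
    change 1 / 2 * (1 / err η w) * err η w + 1 / 2 * (1 / (1 - err η w)) * (1 - err η w) = 1
    field_simp
    norm_num

/-- The weights at which the update is defined: neither factor of it divides by zero. -/
def dom (M : Set (Row m)) (sel : Set (Row m) → Row m) : Set (Simplex m) :=
  {w | 0 < err (best M sel w) w ∧ err (best M sel w) w < 1}

open Classical in
/-- The AdaBoost weight update `A(w) = T_{η^w}(w)`. Outside `dom M sel` the update is undefined;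
the value given there is a placeholder, and every notion below asks for trajectories in `dom`. -/
def update (M : Set (Row m)) (sel : Set (Row m) → Row m) (w : Simplex m) : Simplex m :=
  if h : w ∈ dom M sel then ⟨updateVec (best M sel w) w, updateVec_mem _ w h.1 h.2⟩ else w

/-- `A^(t)(Δ_m)`: the points reached by `t` defined steps of the update. -/
def stepImage (M : Set (Row m)) (sel : Set (Row m) → Row m) (t : ℕ) : Set (Simplex m) :=
  (update M sel)^[t] '' {v | ∀ s < t, (update M sel)^[s] v ∈ dom M sel}

/-- The set `Ω_∞` of non-transient weights. -/
def Omega (M : Set (Row m)) (sel : Set (Row m) → Row m) : Set (Simplex m) :=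
  ⋂ t ∈ Set.Ici 1, stepImage M sel t

/-- Optimal AdaBoost eventually has no ties. -/
def NoTies (M : Set (Row m)) (sel : Set (Row m) → Row m) : Prop :=
  ∃ G : Set (Simplex m), IsCompact G ∧ Omega M sel ⊆ G ∧
    ∀ η ∈ M, ∀ η' ∈ M, sigma M η ∩ sigma M η' ∩ G = ∅ ∨
      ∀ w ∈ G, ∑ i with η i ≠ η' i, w.1 i = 0

/-- `μ` is invariant under the (partially defined) update: the update is defined `μ`-almost
everywhere and preserves `μ`. -/
def IsInvariant (M : Set (Row m)) (sel : Set (Row m) → Row m) (μ : Measure (Simplex m)) : Prop :=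
  μ (dom M sel)ᶜ = 0 ∧ MeasurePreserving (update M sel) μ μ

/-- The least weighted error. -/
def epsilon (M : Set (Row m)) (w : Simplex m) : ℝ := ⨅ η : M, err η.1 w

/-- The coefficient `α(w)`. -/
def alpha (M : Set (Row m)) (w : Simplex m) : ℝ :=
  1 / 2 * Real.log ((1 - epsilon M w) / epsilon M w)

/-- The weight `w_t = A^(t-1)(w₁)`, for `t ≥ 1`. -/
def weight (M : Set (Row m)) (sel : Set (Row m) → Row m) (w₁ : Simplex m) (t : ℕ) : Simplex m :=
  (update M sel)^[t - 1] w₁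

/-- `F_T(x_i) = ∑_{t=1}^T 2 α_t (η_t(i) - 1)`, for the run started at `w₁`. -/
def F (M : Set (Row m)) (sel : Set (Row m) → Row m) (w₁ : Simplex m) (T : ℕ) (i : Fin m) : ℝ :=
  ∑ t ∈ Finset.Icc 1 T, 2 * alpha M (weight M sel w₁ t) *
    (entry (best M sel (weight M sel w₁ t)) i - 1)

/-- A 0-1 label as a label in `{-1, 1}`. -/
def signed (b : Bool) : ℝ := if b then 1 else -1

/-- `∑_{t=1}^T α_t h_t(z)` at an instance `z`, for selected hypotheses `h_t`, with
`{-1, 1}`-valued predictions. -/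
def classifier (M : Set (Row m)) (sel : Set (Row m) → Row m) (w₁ : Simplex m)
    (h : ℕ → X → Bool) (T : ℕ) (z : X) : ℝ :=
  ∑ t ∈ Finset.Icc 1 T, alpha M (weight M sel w₁ t) * signed (h t z)

end AdaBoost

end

/-! Part (b) is Birkhoff's ergodic theorem for `update`, applied to `alpha` times a function of the
selected row. The point is that `alpha` is essentially bounded. An update shrinks no weight by more
than a factor 2 and gives the row it used error exactly 1/2. By pigeonhole some row is selected
twice within `Fintype.card (Row m) + 1` consecutive rounds, which bounds the least error from below
(`pow_card_le_err_best`); it is at most 1/2 after any update. Invariance carries these bounds to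
almost every weight.

Part (a) is the Krylov–Bogolyubov theorem on the closure of `Omega`. The same bounds are closed
conditions, so the update stays defined on the closure. It is continuous there
(`continuousOn_update`): by No Ties, rows tied in `G` differ only on examples of weight zero, so
they update alike. -/

/-! ### Birkhoff's ergodic theorem, from the maximal ergodic inequality -/

section Ergodic

variable {α : Type*} {f : α → α}

/-- The largest of the Birkhoff sums of orders `0, …, n`. -/
def maxBirkhoffSum (f : α → α) (g : α → ℝ) : ℕ → α → ℝ
  | 0, _ => 0
  | n + 1, x => max 0 (g x + maxBirkhoffSum f g n (f x))

theorem maxBirkhoffSum_nonneg (g : α → ℝ) (n : ℕ) (x : α) : 0 ≤ maxBirkhoffSum f g n x := by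
  cases n with
  | zero => exact le_rfl
  | succ n => exact le_max_left _ _

theorem maxBirkhoffSum_le_succ (g : α → ℝ) (n : ℕ) (x : α) :
    maxBirkhoffSum f g n x ≤ maxBirkhoffSum f g (n + 1) x := by
  induction n generalizing x with
  | zero => exact maxBirkhoffSum_nonneg _ _ _
  | succ n ih =>
    change max 0 _ ≤ max 0 _
    have := ih (f x)
    gcongr

theorem birkhoffSum_le_maxBirkhoffSum (g : α → ℝ) (n : ℕ) (x : α) :
    birkhoffSum f g n x ≤ maxBirkhoffSum f g n x := by
  induction n generalizing x with
  | zero => simp [maxBirkhoffSum]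
  | succ n ih =>
    rw [birkhoffSum_succ']
    exact (add_le_add_right (ih (f x)) _).trans (le_max_right _ _)

/-- The gap between `c` and a second rational below `b` absorbs the vanishing difference. -/
theorem frequently_lt_of_tendsto_sub {u v : ℕ → ℝ} (huv : Tendsto (fun n => v n - u n) atTop (𝓝 0))
    {b : ℝ} (h : ∀ c : ℚ, (c : ℝ) < b → ∃ᶠ n in atTop, (c : ℝ) < u n) (c : ℚ) (hc : (c : ℝ) < b) :
    ∃ᶠ n in atTop, (c : ℝ) < v n := by
  obtain ⟨d, hcd, hdb⟩ := exists_rat_btwn hc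
  have hev : ∀ᶠ n in atTop, (c : ℝ) - d < v n - u n :=
    huv.eventually (lt_mem_nhds (by linarith))
  refine ((h d hdb).and_eventually hev).mono fun n hn => ?_
  linarith [hn.1, hn.2]

theorem tendsto_birkhoffAverage_sub_of_bounded {g : α → ℝ} {C : ℝ} (hC : ∀ x, |g x| ≤ C) (x : α) :
    Tendsto (fun n => birkhoffAverage ℝ f g n (f x) - birkhoffAverage ℝ f g n x) atTop (𝓝 0) :=
  tendsto_birkhoffAverage_apply_sub_birkhoffAverage' (𝕜 := ℝ)
    (isBounded_iff_forall_norm_le.2 ⟨C, by rintro _ ⟨y, rfl⟩; exact hC y⟩) f x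

theorem abs_birkhoffAverage_le {g : α → ℝ} {C : ℝ} (hC : ∀ x, |g x| ≤ C) (n : ℕ) (x : α) :
    |birkhoffAverage ℝ f g n x| ≤ C := by
  have hC0 : 0 ≤ C := (abs_nonneg _).trans (hC x)
  rw [birkhoffAverage, smul_eq_mul, abs_mul, abs_of_nonneg (by positivity)]
  rcases n.eq_zero_or_pos with rfl | hn
  · simpa using hC0
  · rw [inv_mul_le_iff₀ (by exact_mod_cast hn)]
    refine (Finset.abs_sum_le_sum_abs _ _).trans ((Finset.sum_le_sum fun k _ => hC _).trans ?_)
    simp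

/-- The points at which the limit superior of the Birkhoff averages is at least `b`. -/
def limsupSet (f : α → α) (g : α → ℝ) (b : ℝ) : Set α :=
  {x | ∀ c : ℚ, (c : ℝ) < b → ∃ᶠ n in atTop, (c : ℝ) < birkhoffAverage ℝ f g n x}

/-- Moving the starting point one step along the orbit changes the averages by a null sequence. The
invariance is exact, so `f` preserves the restriction of `μ` to such a set. -/
theorem preimage_limsupSet {g : α → ℝ} {C : ℝ} (hC : ∀ x, |g x| ≤ C) (b : ℝ) :
    f ⁻¹' limsupSet f g b = limsupSet f g b := by
  ext x
  have h := tendsto_birkhoffAverage_sub_of_bounded (f := f) hC x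
  refine ⟨fun hx => frequently_lt_of_tendsto_sub ?_ hx, fun hx => frequently_lt_of_tendsto_sub h hx⟩
  simpa using h.neg

variable [MeasurableSpace α] {μ : Measure α}

theorem measurable_maxBirkhoffSum {g : α → ℝ} (hf : Measurable f) (hg : Measurable g) (n : ℕ) :
    Measurable (maxBirkhoffSum f g n) := by
  induction n with
  | zero => exact measurable_const
  | succ n ih => exact measurable_const.max (hg.add (ih.comp hf))

theorem integrable_maxBirkhoffSum [IsFiniteMeasure μ] {g : α → ℝ} (hf : MeasurePreserving f μ μ)
    (hg : Integrable g μ) (n : ℕ) : Integrable (maxBirkhoffSum f g n) μ := by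
  induction n with
  | zero => exact integrable_const 0
  | succ n ih => exact (integrable_const 0).sup (hg.add (hf.integrable_comp_of_integrable ih))

/-- The maximal ergodic inequality. -/
theorem setIntegral_maxBirkhoffSum_pos_nonneg [IsFiniteMeasure μ] {g : α → ℝ}
    (hf : MeasurePreserving f μ μ) (hgm : Measurable g) (hg : Integrable g μ) (n : ℕ) :
    0 ≤ ∫ x in {x | 0 < maxBirkhoffSum f g n x}, g x ∂μ := by
  have hM := integrable_maxBirkhoffSum hf hg n
  have hMf := hf.integrable_comp_of_integrable hM
  have hms : MeasurableSet {x | 0 < maxBirkhoffSum f g n x} :=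
    measurableSet_lt measurable_const (measurable_maxBirkhoffSum hf.measurable hgm n)
  rw [← integral_indicator hms]
  have h0 : ∫ x, (maxBirkhoffSum f g n x - maxBirkhoffSum f g n (f x)) ∂μ = 0 := by
    rw [show (fun x => maxBirkhoffSum f g n x - maxBirkhoffSum f g n (f x)) =
      maxBirkhoffSum f g n - maxBirkhoffSum f g n ∘ f from rfl, integral_sub' hM hMf, sub_eq_zero]
    have := integral_map (μ := μ) hf.measurable.aemeasurable (f := maxBirkhoffSum f g n)
      (measurable_maxBirkhoffSum hf.measurable hgm n).aestronglyMeasurable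
    rw [hf.map_eq] at this
    exact this
  -- With `S` the maximal sum of order `n`, `S - S ∘ f` has integral zero and lies below the
  -- indicator of `S > 0` times `g`: where `S > 0` the maximum is `g` plus an earlier sum at `f x`,
  -- and elsewhere `S = 0 ≤ S ∘ f`.
  refine h0.symm.le.trans (integral_mono (hM.sub hMf) (hg.indicator hms) fun x => ?_)
  by_cases hx : 0 < maxBirkhoffSum f g n x
  · rw [Set.indicator_of_mem (show x ∈ {x | 0 < maxBirkhoffSum f g n x} from hx)]
    cases n with
    | zero => exact absurd hx (lt_irrefl _)
    | succ n =>
      have h1 : maxBirkhoffSum f g (n + 1) x = max 0 (g x + maxBirkhoffSum f g n (f x)) := rfl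
      have h2 := maxBirkhoffSum_le_succ (f := f) g n (f x)
      rcases max_cases 0 (g x + maxBirkhoffSum f g n (f x)) with h | h <;> linarith
  · rw [Set.indicator_of_notMem (show x ∉ {x | 0 < maxBirkhoffSum f g n x} from hx)]
    have := maxBirkhoffSum_nonneg (f := f) g n (f x)
    linarith [not_lt.1 hx]

/-- The sets in the maximal inequality increase to a set of full measure. -/
theorem integral_nonneg_of_ae_exists_birkhoffSum_pos [IsFiniteMeasure μ] {g : α → ℝ}
    (hf : MeasurePreserving f μ μ) (hgm : Measurable g) (hg : Integrable g μ)
    (h : ∀ᵐ x ∂μ, ∃ n, 0 < birkhoffSum f g n x) : 0 ≤ ∫ x, g x ∂μ := by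
  have hms : ∀ n, MeasurableSet {x | 0 < maxBirkhoffSum f g n x} := fun n =>
    measurableSet_lt measurable_const (measurable_maxBirkhoffSum hf.measurable hgm n)
  have hmono : Monotone fun n => {x | 0 < maxBirkhoffSum f g n x} :=
    monotone_nat_of_le_succ fun n x hx => lt_of_lt_of_le hx (maxBirkhoffSum_le_succ g n x)
  have hlim := tendsto_setIntegral_of_monotone (μ := μ) (f := g) hms hmono hg.integrableOn
  have huniv : (⋃ n, {x | 0 < maxBirkhoffSum f g n x}) =ᵐ[μ] Set.univ := by
    rw [ae_eq_univ, ← mem_ae_iff]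
    filter_upwards [h] with x ⟨n, hn⟩
    exact Set.mem_iUnion.2 ⟨n, hn.trans_le (birkhoffSum_le_maxBirkhoffSum g n x)⟩
  rw [setIntegral_congr_set huniv, setIntegral_univ] at hlim
  exact ge_of_tendsto' hlim fun n => setIntegral_maxBirkhoffSum_pos_nonneg hf hgm hg n

/-- If the Birkhoff averages exceed `c` somewhere along almost every orbit in an invariant set,
then the function has mean at least `c` there. -/
theorem mul_measureReal_le_setIntegral_of_frequently [IsFiniteMeasure μ] {g : α → ℝ}
    (hf : MeasurePreserving f μ μ) (hgm : Measurable g) (hg : Integrable g μ) {E : Set α}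
    (hE : MeasurableSet E) (hfE : f ⁻¹' E = E) {c : ℝ}
    (h : ∀ x ∈ E, ∃ᶠ n in atTop, c < birkhoffAverage ℝ f g n x) :
    c * μ.real E ≤ ∫ x in E, g x ∂μ := by
  have hfr : MeasurePreserving f (μ.restrict E) (μ.restrict E) := by
    have := hf.restrict_preimage hE
    rwa [hfE] at this
  have := integral_nonneg_of_ae_exists_birkhoffSum_pos hfr (g := g - fun _ => c)
    (hgm.sub measurable_const) (hg.integrableOn.sub (integrable_const c)) ?_
  · simp only [Pi.sub_apply] at this
    rw [integral_sub hg.integrableOn (integrable_const c)] at this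
    simp only [integral_const, measureReal_restrict_apply_univ, smul_eq_mul] at this
    linarith
  · filter_upwards [ae_restrict_mem hE] with x hx
    obtain ⟨n, hn, hn1⟩ := ((h x hx).and_eventually (eventually_ge_atTop 1)).exists
    refine ⟨n, ?_⟩
    have hn0 : (0 : ℝ) < n := by exact_mod_cast hn1
    rw [birkhoffAverage, smul_eq_mul, inv_mul_eq_div, lt_div_iff₀ hn0] at hn
    rw [birkhoffSum_sub]
    simp only [birkhoffSum, Finset.sum_const, Finset.card_range, nsmul_eq_mul]
      at hn ⊢
    linarith

theorem measurable_birkhoffAverage {g : α → ℝ} (hf : Measurable f) (hg : Measurable g) (n : ℕ) :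
    Measurable (birkhoffAverage ℝ f g n) := by
  have h : Measurable (birkhoffSum f g n) :=
    Finset.measurable_sum _ fun k _ => hg.comp (hf.iterate k)
  exact h.const_smul (n : ℝ)⁻¹

theorem measurableSet_limsupSet {g : α → ℝ} (hf : Measurable f) (hg : Measurable g) (b : ℝ) :
    MeasurableSet (limsupSet f g b) := by
  simp only [limsupSet, frequently_atTop, Set.ofPred_forall, Set.ofPred_exists, Set.ofPred_and]
  refine .iInter fun c => .iInter fun _ => .iInter fun N => .iUnion fun n => ?_
  exact (MeasurableSet.const _).inter
    (measurableSet_lt measurable_const (measurable_birkhoffAverage hf hg n))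

/-- Birkhoff's pointwise ergodic theorem for a bounded function. -/
theorem ae_exists_tendsto_birkhoffAverage_of_bounded [IsFiniteMeasure μ] {g : α → ℝ}
    (hf : MeasurePreserving f μ μ) (hgm : Measurable g) {C : ℝ} (hC : ∀ x, |g x| ≤ C) :
    ∀ᵐ x ∂μ, ∃ L : ℝ, Tendsto (fun n => birkhoffAverage ℝ f g n x) atTop (𝓝 L) := by
  have hg : Integrable g μ := .of_bound hgm.aestronglyMeasurable C (ae_of_all _ hC)
  have hC' : ∀ x, |(-g) x| ≤ C := fun x => by simpa using hC x
  have key : ∀ a b : ℚ, a < b → ∀ᵐ x ∂μ,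
      x ∉ limsupSet f g b ∩ limsupSet f (-g) (-a) := by
    intro a b hab
    set E := limsupSet f g b ∩ limsupSet f (-g) (-a)
    have hE : MeasurableSet E := (measurableSet_limsupSet hf.measurable hgm _).inter
      (measurableSet_limsupSet hf.measurable hgm.neg _)
    -- On `E` the upper limit is at least `b` and the lower limit at most `a`. The integral of `g`
    -- over `E` is then at least `c` and at most `d < c` times the measure of `E`, which must
    -- vanish.
    have hfE : f ⁻¹' E = E := by
      rw [Set.preimage_inter, preimage_limsupSet hC, preimage_limsupSet hC']
    obtain ⟨d, had, hdb⟩ := exists_between hab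
    obtain ⟨c, hdc, hcb⟩ := exists_between hdb
    have h1 := mul_measureReal_le_setIntegral_of_frequently hf hgm hg hE hfE (c := c)
      fun x hx => hx.1 c (by exact_mod_cast hcb)
    have h2 := mul_measureReal_le_setIntegral_of_frequently hf hgm.neg hg.neg hE hfE
      (c := ((-d : ℚ) : ℝ)) fun x hx => hx.2 (-d) (by push_cast; exact neg_lt_neg (by exact_mod_cast had))
    simp only [Pi.neg_apply, integral_neg] at h2
    have hcd : (d : ℝ) < c := by exact_mod_cast hdc
    have h0 : μ.real E = 0 := by
      refine le_antisymm ?_ measureReal_nonneg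
      push_cast at h2
      nlinarith
    rw [ae_iff]
    simpa [measureReal_eq_zero_iff] using h0
  have := ae_all_iff.2 fun a : ℚ => ae_all_iff.2 fun b : ℚ => ae_all_iff.2 (key a b)
  filter_upwards [this] with x hx
  refine tendsto_of_no_upcrossings (s := Set.range ((↑) : ℚ → ℝ)) Rat.isDenseEmbedding_coe_real.dense ?_
    ⟨C, ?_⟩ ⟨-C, ?_⟩
  · rintro _ ⟨a, rfl⟩ _ ⟨b, rfl⟩ hab ⟨h1, h2⟩
    refine hx a b (by exact_mod_cast hab) ⟨fun c hc => h2.mono fun n hn => hc.trans hn, fun c hc => ?_⟩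
    refine h1.mono fun n hn => ?_
    rw [birkhoffAverage_neg, Pi.neg_apply]
    simp only [Pi.neg_apply]
    linarith
  · exact eventually_map.2 (Eventually.of_forall fun n => (abs_le.1 (abs_birkhoffAverage_le hC n x)).2)
  · exact eventually_map.2 (Eventually.of_forall fun n => (abs_le.1 (abs_birkhoffAverage_le hC n x)).1)

/-- Birkhoff's pointwise ergodic theorem for an essentially bounded function. -/
theorem ae_exists_tendsto_birkhoffAverage [IsFiniteMeasure μ] {g : α → ℝ}
    (hf : MeasurePreserving f μ μ) (hgm : Measurable g) {C : ℝ} (hC : ∀ᵐ x ∂μ, |g x| ≤ C) :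
    ∀ᵐ x ∂μ, ∃ L : ℝ, Tendsto (fun n => birkhoffAverage ℝ f g n x) atTop (𝓝 L) := by
  -- Truncation changes nothing along almost every orbit.
  let g' : α → ℝ := fun x => if |g x| ≤ C then g x else 0
  have hgm' : Measurable g' :=
    Measurable.ite (measurableSet_le hgm.abs measurable_const) hgm measurable_const
  have hC' : ∀ x, |g' x| ≤ |C| := by
    intro x
    by_cases h : |g x| ≤ C
    · simp only [g', if_pos h]; exact h.trans (le_abs_self C)
    · simp only [g', if_neg h, abs_zero]; exact abs_nonneg C
  have horb : ∀ᵐ x ∂μ, ∀ n, |g (f^[n] x)| ≤ C :=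
    ae_all_iff.2 fun n => (hf.iterate n).quasiMeasurePreserving.ae hC
  filter_upwards [ae_exists_tendsto_birkhoffAverage_of_bounded hf hgm' hC', horb] with x ⟨L, hL⟩ hx
  refine ⟨L, hL.congr fun n => ?_⟩
  simp only [birkhoffAverage, birkhoffSum]
  congr 1
  exact Finset.sum_congr rfl fun k _ => if_pos (hx k)

end Ergodic

/-- The Krylov–Bogolyubov theorem. -/
theorem exists_isProbabilityMeasure_measurePreserving {K : Type*} [TopologicalSpace K]
    [CompactSpace K] [TopologicalSpace.MetrizableSpace K] [Nonempty K] [MeasurableSpace K]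
    [BorelSpace K] {f : K → K} (hf : Continuous f) :
    ∃ μ : Measure K, IsProbabilityMeasure μ ∧ MeasurePreserving f μ μ := by
  obtain ⟨x⟩ := ‹Nonempty K›
  let ν : ℕ → Measure K := fun n =>
    ((n : ENNReal) + 1)⁻¹ • ∑ k ∈ Finset.range (n + 1), Measure.dirac (f^[k] x)
  have hν : ∀ n, IsProbabilityMeasure (ν n) := fun n => ⟨by
    simp only [ν, Measure.smul_apply, Measure.finsetSum_apply, measure_univ, Finset.sum_const,
      Finset.card_range, smul_eq_mul, nsmul_eq_mul, mul_one]
    push_cast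
    exact ENNReal.inv_mul_cancel (by positivity) (by finiteness)⟩
  have hint : ∀ (g : C(K, ℝ)) n, ∫ y, g y ∂(ν n) = birkhoffAverage ℝ f g (n + 1) x := by
    intro g n
    simp only [ν, integral_smul_measure, birkhoffAverage, birkhoffSum]
    rw [integral_finsetSum_measure fun k _ => integrable_dirac (by finiteness)]
    simp [ENNReal.toReal_add]
  let P : ℕ → ProbabilityMeasure K := fun n => ⟨ν n, hν n⟩
  -- Compactness of the space of probability measures gives a limit of the empirical measures along
  -- any ultrafilter, with no need to extract a subsequence.
  let U : Ultrafilter ℕ := Ultrafilter.of atTop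
  obtain ⟨p, -, hp⟩ := isCompact_univ.ultrafilter_le_nhds (U.map P) (by simp)
  have hp : Tendsto P U (𝓝 p) := hp
  rw [ProbabilityMeasure.tendsto_iff_forall_integral_tendsto] at hp
  refine ⟨p, inferInstance, hf.measurable, ?_⟩
  have := Measure.isProbabilityMeasure_map (μ := (p : Measure K)) hf.measurable.aemeasurable
  refine ext_of_forall_integral_eq_of_IsFiniteMeasure fun g => ?_
  rw [integral_map hf.measurable.aemeasurable g.continuous.aestronglyMeasurable]
  have h1 := hp (g.compContinuous ⟨f, hf⟩)
  have h2 := hp g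
  refine sub_eq_zero.1 (tendsto_nhds_unique (h1.sub h2) ?_)
  have h3 : Tendsto (fun n => birkhoffAverage ℝ f g (n + 1) (f x) -
      birkhoffAverage ℝ f g (n + 1) x) atTop (𝓝 0) :=
    (tendsto_birkhoffAverage_sub_of_bounded (C := ‖g‖) (fun y => g.norm_coe_le_norm y) x).comp
      (tendsto_add_atTop_nat 1)
  refine (h3.mono_left (Ultrafilter.of_le atTop)).congr fun n => ?_
  have e1 := hint ((g.compContinuous ⟨f, hf⟩).toContinuousMap) n
  have e2 := hint g.toContinuousMap n
  have e3 : birkhoffAverage ℝ f g (n + 1) (f x) =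
      birkhoffAverage ℝ f (g ∘ f) (n + 1) x := by
    simp only [birkhoffAverage, birkhoffSum, Function.comp_apply, ← Function.iterate_succ_apply,
      ← Function.iterate_succ_apply']
  rw [e3]
  exact (congrArg₂ (· - ·) e1 e2).symm

/-! ### Bounds on the weighted errors along a run -/

noncomputable section

namespace AdaBoost

variable {m : ℕ} {M : Set (Row m)} {sel : Set (Row m) → Row m}

theorem entry_nonneg (η : Row m) (i : Fin m) : 0 ≤ entry η i := Nat.cast_nonneg _

theorem continuous_err (η : Row m) : Continuous (err η) :=
  continuous_finsetSum _ fun i _ =>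
    continuous_const.mul ((continuous_apply i).comp continuous_subtype_val)

theorem argminRows_nonempty (hM : M.Nonempty) (w : Simplex m) : (argminRows M w).Nonempty := by
  obtain ⟨η, hη, h⟩ := M.toFinite.exists_minimalFor (fun η => err η w) M hM
  exact ⟨η, hη, fun η' hη' => (le_total _ _).elim id fun h' => h hη' h'⟩

theorem best_mem_argminRows (hM : M.Nonempty) (hsel : ∀ s ⊆ M, s.Nonempty → sel s ∈ s)
    (w : Simplex m) : best M sel w ∈ argminRows M w :=
  hsel _ (fun _ h => h.1) (argminRows_nonempty hM w)

theorem epsilon_eq_err_best (hM : M.Nonempty) (hsel : ∀ s ⊆ M, s.Nonempty → sel s ∈ s)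
    (w : Simplex m) : epsilon M w = err (best M sel w) w := by
  have hb := best_mem_argminRows hM hsel w
  have := hM.to_subtype
  refine le_antisymm ?_ (le_ciInf fun η : M => hb.2 _ η.2)
  exact ciInf_le (f := fun η : M => err η.1 w) (Set.finite_range _).bddBelow
    (⟨best M sel w, hb.1⟩ : M)

theorem update_val (w : Simplex m) (hw : w ∈ dom M sel) :
    (update M sel w).1 = updateVec (best M sel w) w := by
  rw [update, dif_pos hw]

/-- Both factors `1 / err` and `1 / (1 - err)` are at least 1. -/
theorem half_mul_le_update (w : Simplex m) (hw : w ∈ dom M sel) (i : Fin m) :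
    1 / 2 * w.1 i ≤ (update M sel w).1 i := by
  rw [update_val w hw, updateVec]
  have h0 := hw.1
  have h1 : 0 < 1 - err (best M sel w) w := sub_pos.2 hw.2
  have hi : 0 ≤ 1 / 2 * w.1 i := mul_nonneg (by norm_num) (w.2.1 i)
  rw [mul_assoc]
  refine le_mul_of_one_le_right hi (one_le_mul_of_one_le_of_one_le
    (one_le_pow₀ ?_) (one_le_pow₀ ?_))
  · exact one_le_one_div h0 hw.2.le
  · exact one_le_one_div h1 (by linarith)

theorem half_mul_err_le_err_update (η : Row m) (w : Simplex m) (hw : w ∈ dom M sel) :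
    1 / 2 * err η w ≤ err η (update M sel w) := by
  rw [err, err, Finset.mul_sum]
  refine Finset.sum_le_sum fun i _ => ?_
  have := mul_le_mul_of_nonneg_left (half_mul_le_update w hw i) (entry_nonneg η i)
  linarith

theorem err_best_update (w : Simplex m) (hw : w ∈ dom M sel) :
    err (best M sel w) (update M sel w) = 1 / 2 := by
  have h : ∀ i, entry (best M sel w) i * (update M sel w).1 i =
      1 / 2 * (1 / err (best M sel w) w) * (entry (best M sel w) i * w.1 i) := by
    intro i
    rw [update_val w hw]
    unfold updateVec entry
    cases best M sel w i
    · simp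
    · simp only [Bool.toNat_true]; norm_num; ring
  rw [err, Finset.sum_congr rfl fun i _ => h i, ← Finset.mul_sum]
  change 1 / 2 * (1 / err (best M sel w) w) * err (best M sel w) w = 1 / 2
  have := hw.1.ne'
  field_simp

theorem pow_mul_err_le_err_iterate (η : Row m) (w : Simplex m) (n : ℕ)
    (hw : ∀ k < n, (update M sel)^[k] w ∈ dom M sel) :
    (1 / 2) ^ n * err η w ≤ err η ((update M sel)^[n] w) := by
  induction n with
  | zero => simp
  | succ n ih =>
    have h1 := ih fun k hk => hw k (hk.trans n.lt_succ_self)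
    have h2 := half_mul_err_le_err_update η _ (hw n n.lt_succ_self)
    rw [Function.iterate_succ_apply', pow_succ']
    linarith

theorem err_best_le_half (hM : M.Nonempty) (hsel : ∀ s ⊆ M, s.Nonempty → sel s ∈ s)
    {n : ℕ} (hn : 1 ≤ n) {w : Simplex m} (hw : w ∈ stepImage M sel n) :
    err (best M sel w) w ≤ 1 / 2 := by
  obtain ⟨v, hv, rfl⟩ := hw
  obtain ⟨n, rfl⟩ := Nat.exists_eq_add_of_le' hn
  have hd := hv n n.lt_succ_self
  rw [Function.iterate_succ_apply', ← err_best_update _ hd]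
  exact (best_mem_argminRows hM hsel _).2 _ (best_mem_argminRows hM hsel _).1

/-- After as many rounds as there are rows the least weighted error is bounded away from zero. -/
theorem pow_card_le_err_best (hM : M.Nonempty) (hsel : ∀ s ⊆ M, s.Nonempty → sel s ∈ s)
    {w : Simplex m} (hw : w ∈ stepImage M sel (Fintype.card (Row m))) :
    (1 / 2) ^ Fintype.card (Row m) ≤ err (best M sel w) w := by
  obtain ⟨v, hv, rfl⟩ := hw
  have hv : ∀ s < Fintype.card (Row m), (update M sel)^[s] v ∈ dom M sel := hv
  set n := Fintype.card (Row m) with hn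
  -- A row selected at times `s < t` has error 1/2 at time `s + 1`, hence at least `(1/2)^(t-s)` at
  -- time `t`. It is optimal then, so every row in `M` has at least that error, and at least
  -- `(1/2)^(n-s)` at time `n`.
  obtain ⟨s, t, hne, hst⟩ := Fintype.exists_ne_map_eq_of_card_lt
    (fun s : Fin (n + 1) => best M sel ((update M sel)^[s] v)) (by simp [hn])
  wlog hlt : s < t generalizing s t
  · exact this t s hne.symm hst.symm (lt_of_le_of_ne (not_lt.1 hlt) hne.symm)
  obtain ⟨k, hk⟩ := Nat.exists_eq_add_of_lt (Fin.lt_def.1 hlt)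
  obtain ⟨l, hl⟩ := Nat.exists_eq_add_of_le (Nat.le_of_lt_succ t.2)
  have hsn : (s : ℕ) < n := by omega
  have h1 := pow_mul_err_le_err_iterate (best M sel ((update M sel)^[s] v))
    ((update M sel)^[s + 1] v) k fun j hj => by
      rw [← Function.iterate_add_apply]; exact hv _ (by omega)
  rw [← Function.iterate_add_apply, Function.iterate_succ_apply', err_best_update _ (hv s hsn),
    show k + (s + 1) = (t : ℕ) by omega] at h1
  have h2 := (best_mem_argminRows hM hsel ((update M sel)^[t] v)).2 _
    (best_mem_argminRows hM hsel ((update M sel)^[n] v)).1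
  have h3 := pow_mul_err_le_err_iterate (best M sel ((update M sel)^[n] v))
    ((update M sel)^[t] v) l fun j hj => by
      rw [← Function.iterate_add_apply]; exact hv _ (by omega)
  rw [← Function.iterate_add_apply, show l + (t : ℕ) = n by omega] at h3
  rw [show best M sel ((update M sel)^[s] v) = best M sel ((update M sel)^[t] v) from hst] at h1
  calc (1 / 2 : ℝ) ^ n ≤ (1 / 2) ^ (l + (k + 1)) :=
        pow_le_pow_of_le_one (by norm_num) (by norm_num) (by omega)
    _ = (1 / 2) ^ l * ((1 / 2) ^ k * (1 / 2)) := by rw [pow_add, pow_succ]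
    _ ≤ (1 / 2) ^ l * err (best M sel ((update M sel)^[n] v)) ((update M sel)^[t] v) := by
        gcongr; exact h1.trans h2
    _ ≤ _ := h3

theorem stepImage_subset_dom (hM : M.Nonempty) (hsel : ∀ s ⊆ M, s.Nonempty → sel s ∈ s) :
    stepImage M sel (Fintype.card (Row m)) ⊆ dom M sel := fun w hw => by
  have h1 := pow_card_le_err_best hM hsel hw
  have h2 := err_best_le_half hM hsel Fintype.card_pos hw
  exact ⟨lt_of_lt_of_le (by positivity) h1, by linarith⟩

theorem abs_alpha_le (hM : M.Nonempty) (hsel : ∀ s ⊆ M, s.Nonempty → sel s ∈ s)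
    {w : Simplex m} (hw : w ∈ stepImage M sel (Fintype.card (Row m))) :
    |alpha M w| ≤ 1 / 2 * Real.log (2 ^ Fintype.card (Row m)) := by
  have h1 := pow_card_le_err_best hM hsel hw
  have h2 := err_best_le_half hM hsel Fintype.card_pos hw
  have h0 : 0 < err (best M sel w) w := lt_of_lt_of_le (by positivity) h1
  rw [alpha, epsilon_eq_err_best hM hsel, abs_of_nonneg]
  · gcongr
    · exact div_pos (by linarith) h0
    · rw [div_le_iff₀ h0]
      have : (1 : ℝ) = 2 ^ Fintype.card (Row m) * (1 / 2) ^ Fintype.card (Row m) := by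
        rw [← mul_pow]; norm_num
      have := mul_le_mul_of_nonneg_left h1 (by positivity : (0 : ℝ) ≤ 2 ^ Fintype.card (Row m))
      linarith
  · refine mul_nonneg (by norm_num) (Real.log_nonneg ?_)
    rw [le_div_iff₀ h0]
    linarith

/-! ### Measurability, and the essential bound on `alpha` -/

theorem measurable_best : Measurable (best M sel) := by
  have h : Measurable (argminRows M) := by
    refine measurable_set_iff.2 fun η => ?_
    refine measurable_to_prop ?_
    have : (fun w => η ∈ argminRows M w) ⁻¹' {True} =
        {w | η ∈ M} ∩ ⋂ η' ∈ M, {w | err η w ≤ err η' w} := by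
      ext w; simp [argminRows]
    rw [this]
    exact (MeasurableSet.const _).inter (.biInter M.to_countable fun η' _ =>
      measurableSet_le (continuous_err η).measurable (continuous_err η').measurable)
  -- There are finitely many sets of rows, so an arbitrary tie-breaking rule is measurable.
  exact (measurable_of_countable sel).comp h

theorem measurable_comp_best {β : Type*} [MeasurableSpace β] {f : Row m → Simplex m → β}
    (hf : ∀ η, Measurable (f η)) : Measurable fun w => f (best M sel w) w :=
  (measurable_from_prod_countable_right (f := fun p : Row m × Simplex m => f p.1 p.2) hf).comp
    (measurable_best.prodMk measurable_id)

theorem measurableSet_dom : MeasurableSet (dom M sel) := by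
  have h : Measurable fun w => err (best M sel w) w :=
    measurable_comp_best fun η => (continuous_err η).measurable
  exact (measurableSet_lt measurable_const h).inter (measurableSet_lt h measurable_const)

theorem measurable_update : Measurable (update M sel) := by
  classical
  have h : ∀ w, (update M sel w).1 =
      if w ∈ dom M sel then updateVec (best M sel w) w else w.1 := by
    intro w
    split_ifs with hw
    · exact update_val w hw
    · rw [update, dif_neg hw]
  have : Measurable fun w => (update M sel w).1 := by
    simp_rw [h]
    refine Measurable.ite measurableSet_dom ?_ measurable_subtype_coe
    refine measurable_comp_best fun η => measurable_pi_lambda _ fun i => ?_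
    have := (continuous_err η).measurable
    have hi : Measurable fun w : Simplex m => w.1 i :=
      (measurable_pi_apply i).comp measurable_subtype_coe
    unfold updateVec
    exact ((measurable_const.mul hi).mul ((measurable_const.div this).pow_const _)).mul
      ((measurable_const.div (measurable_const.sub this)).pow_const _)
  exact this.subtype_mk

theorem measurable_alpha : Measurable (alpha M) := by
  have h : Measurable (epsilon M) := Measurable.iInf fun η => (continuous_err η.1).measurable
  unfold alpha
  fun_prop

theorem ae_abs_alpha_le (hM : M.Nonempty) (hsel : ∀ s ⊆ M, s.Nonempty → sel s ∈ s)
    {μ : Measure (Simplex m)} (hμ : IsInvariant M sel μ) :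
    ∀ᵐ w ∂μ, |alpha M w| ≤ 1 / 2 * Real.log (2 ^ Fintype.card (Row m)) := by
  have hd : ∀ᵐ w ∂μ, w ∈ dom M sel := mem_ae_iff.2 hμ.1
  have horb : ∀ᵐ w ∂μ, ∀ n, (update M sel)^[n] w ∈ dom M sel :=
    ae_all_iff.2 fun n => (hμ.2.iterate n).quasiMeasurePreserving.ae hd
  have hmp := hμ.2.iterate (Fintype.card (Row m))
  -- Pulling back the measurable set where the bound holds avoids asking whether the image
  -- `stepImage` is measurable.
  rw [← hmp.map_eq, ae_map_iff hmp.measurable.aemeasurable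
    (measurableSet_le measurable_alpha.abs measurable_const)]
  filter_upwards [horb] with w hw
  exact abs_alpha_le hM hsel ⟨w, fun s _ => hw s, rfl⟩

/-! ### Continuity of the update and existence of an invariant measure -/

theorem mapsTo_update_Omega (hM : M.Nonempty) (hsel : ∀ s ⊆ M, s.Nonempty → sel s ∈ s) :
    Set.MapsTo (update M sel) (Omega M sel) (Omega M sel) := by
  intro w hw
  have hw' : ∀ t ≥ 1, w ∈ stepImage M sel t := Set.mem_iInter₂.1 hw
  have hd := stepImage_subset_dom hM hsel (hw' _ Fintype.card_pos)
  refine Set.mem_iInter₂.2 fun t ht => ?_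
  obtain ⟨t, rfl⟩ := Nat.exists_eq_add_of_le' (Set.mem_Ici.1 ht)
  have hwt : w ∈ stepImage M sel t := by
    rcases t.eq_zero_or_pos with rfl | h
    · exact ⟨w, by simp, rfl⟩
    · exact hw' t h
  obtain ⟨v, hv, rfl⟩ := hwt
  refine ⟨v, fun s hs => ?_, Function.iterate_succ_apply' _ _ _⟩
  rcases Nat.lt_succ_iff_lt_or_eq.1 hs with h | rfl
  · exact hv s h
  · exact hd

theorem continuousOn_updateVec (η : Row m) :
    ContinuousOn (updateVec η) {w : Simplex m | 0 < err η w ∧ err η w < 1} := by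
  have he := (continuous_err η).continuousOn (s := {w : Simplex m | 0 < err η w ∧ err η w < 1})
  refine continuousOn_pi.2 fun i => ?_
  have hi : Continuous fun w : Simplex m => w.1 i :=
    (continuous_apply i).comp continuous_subtype_val
  exact ((continuousOn_const.mul hi.continuousOn).mul
    ((continuousOn_const.div he fun w hw => hw.1.ne').pow _)).mul
    ((continuousOn_const.div (continuousOn_const.sub he)
      fun w hw => (sub_pos.2 hw.2).ne').pow _)

/-- Being strictly worse than an optimal row is an open condition, and there are finitely many rows.
-/
theorem eventually_argminRows_subset (hM : M.Nonempty) (w : Simplex m) :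
    ∀ᶠ w' in 𝓝 w, argminRows M w' ⊆ argminRows M w := by
  obtain ⟨η₀, hη₀⟩ := argminRows_nonempty hM w
  have h : ∀ η : Row m, ∀ᶠ w' in 𝓝 w, η ∈ argminRows M w' → η ∈ argminRows M w := by
    intro η
    by_cases hlt : err η₀ w < err η w
    · filter_upwards [(continuous_err η₀).continuousAt.eventually_lt
        (continuous_err η).continuousAt hlt] with w' hw' hη
      exact absurd (hη.2 _ hη₀.1) (not_le.2 hw')
    · exact Eventually.of_forall fun w' hη =>
        ⟨hη.1, fun η' hη' => (not_lt.1 hlt).trans (hη₀.2 _ hη')⟩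
  filter_upwards [eventually_all.2 h] with w' hw' η hη using hw' η hη

theorem updateVec_congr {η η' : Row m} {w : Simplex m}
    (h : ∑ i with η i ≠ η' i, w.1 i = 0) : updateVec η w = updateVec η' w := by
  have h0 : ∀ i, η i ≠ η' i → w.1 i = 0 := fun i hi =>
    (Finset.sum_eq_zero_iff_of_nonneg fun i _ => w.2.1 i).1 h i (by simpa using hi)
  have he : err η w = err η' w := by
    refine Finset.sum_congr rfl fun i _ => ?_
    by_cases hi : η i = η' i
    · rw [entry, entry, hi]
    · rw [h0 i hi, mul_zero, mul_zero]
  funext i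
  by_cases hi : η i = η' i
  · rw [updateVec, updateVec, he, hi]
  · simp [updateVec, h0 i hi]

theorem continuousOn_update (hM : M.Nonempty) (hsel : ∀ s ⊆ M, s.Nonempty → sel s ∈ s)
    {G : Set (Simplex m)} (hG : ∀ η ∈ M, ∀ η' ∈ M, sigma M η ∩ sigma M η' ∩ G = ∅ ∨
      ∀ w ∈ G, ∑ i with η i ≠ η' i, w.1 i = 0) :
    ContinuousOn (update M sel) (G ∩ dom M sel) := by
  rintro w ⟨hwG, hwd⟩
  rw [ContinuousWithinAt, tendsto_subtype_rng, update_val w hwd]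
  have hb := best_mem_argminRows hM hsel w
  have hopen : {w' : Simplex m | 0 < err (best M sel w) w' ∧ err (best M sel w) w' < 1} ∈ 𝓝 w :=
    ((isOpen_lt continuous_const (continuous_err _)).inter
      (isOpen_lt (continuous_err _) continuous_const)).mem_nhds hwd
  have hc : Tendsto (updateVec (best M sel w)) (𝓝[G ∩ dom M sel] w)
      (𝓝 (updateVec (best M sel w) w)) :=
    ((continuousOn_updateVec _).continuousAt hopen).mono_left nhdsWithin_le_nhds
  refine hc.congr' ?_
  filter_upwards [nhdsWithin_le_nhds (eventually_argminRows_subset hM w), self_mem_nhdsWithin]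
    with w' hsub hw'
  rw [update_val w' hw'.2]
  have hb' := best_mem_argminRows hM hsel w'
  -- The row selected at the nearby `w'` is also optimal at `w`, so the two rows are tied at `w ∈ G`
  -- and the disjointness alternative fails.
  rcases hG _ hb.1 _ hb'.1 with h | h
  · exact absurd (show w ∈ sigma M _ ∩ sigma M _ ∩ G from ⟨⟨hb, hsub hb'⟩, hwG⟩) (h ▸ Set.notMem_empty w)
  · exact updateVec_congr (h w' hw'.1)

theorem exists_isInvariant (hM : M.Nonempty) (hsel : ∀ s ⊆ M, s.Nonempty → sel s ∈ s)
    (hNT : NoTies M sel) (hne : (Omega M sel).Nonempty) :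
    ∃ μ : Measure (Simplex m), IsProbabilityMeasure μ ∧ IsInvariant M sel μ := by
  obtain ⟨G, hGc, hOG, hG⟩ := hNT
  set c : ℝ := (1 / 2) ^ Fintype.card (Row m)
  -- Stated row by row, the error bounds cut out a closed set, so they persist on the closure of
  -- `Omega` and keep it inside `dom`.
  have hOK : Omega M sel ⊆ {w | (∀ η ∈ M, c ≤ err η w) ∧ ∃ η ∈ M, err η w ≤ 1 / 2} := by
    intro w hw
    have hw' := Set.mem_iInter₂.1 hw _ (Set.mem_Ici.2 (Fintype.card_pos (α := Row m)))
    have hb := best_mem_argminRows hM hsel w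
    exact ⟨fun η hη => (pow_card_le_err_best hM hsel hw').trans (hb.2 η hη),
      _, hb.1, err_best_le_half hM hsel Fintype.card_pos hw'⟩
  have hcl : IsClosed {w : Simplex m | (∀ η ∈ M, c ≤ err η w) ∧ ∃ η ∈ M, err η w ≤ 1 / 2} := by
    have h1 : IsClosed (⋂ η ∈ M, {w : Simplex m | c ≤ err η w}) :=
      isClosed_biInter fun η _ => isClosed_le continuous_const (continuous_err η)
    have h2 : IsClosed (⋃ η ∈ M, {w : Simplex m | err η w ≤ 1 / 2}) :=
      M.toFinite.isClosed_biUnion fun η _ => isClosed_le (continuous_err η) continuous_const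
    convert! h1.inter h2
    ext w
    simp
  have hKd : closure (Omega M sel) ⊆ G ∩ dom M sel := by
    refine Set.subset_inter (closure_minimal hOG hGc.isClosed) fun w hw => ?_
    obtain ⟨h1, η, hη, h2⟩ := closure_minimal hOK hcl hw
    have hb := best_mem_argminRows hM hsel w
    exact ⟨lt_of_lt_of_le (by positivity) (h1 _ hb.1), by linarith [hb.2 η hη]⟩
  have hcont := (continuousOn_update hM hsel hG).mono hKd
  have hmaps := (mapsTo_update_Omega hM hsel).closure_of_continuousOn hcont
  have hKne : Nonempty (closure (Omega M sel)) := hne.closure.to_subtype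
  have : CompactSpace (closure (Omega M sel)) :=
    isCompact_iff_compactSpace.1 isClosed_closure.isCompact
  obtain ⟨ν, hν, hinv⟩ := exists_isProbabilityMeasure_measurePreserving
    (hcont.mapsToRestrict hmaps)
  have hval : Measurable ((↑) : closure (Omega M sel) → Simplex m) := measurable_subtype_coe
  refine ⟨ν.map (↑), Measure.isProbabilityMeasure_map hval.aemeasurable, ?_, measurable_update, ?_⟩
  · rw [Measure.map_apply hval measurableSet_dom.compl]
    convert! measure_empty (μ := ν)
    ext w
    simpa using (hKd w.2).2
  · rw [Measure.map_map measurable_update hval]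
    conv_rhs => rw [← hinv.map_eq, Measure.map_map hval hinv.measurable]
    rfl

/-! ### Convergence of the averages -/

/-- The prediction on a training example depends on the hypothesis only through its error row, so
one null set serves all choices of `h_t`. -/
theorem signed_eq_of_errorRow {X : Type*} {x : Fin m → X} {y : Fin m → Bool} {h : X → Bool}
    {η : Row m} (hη : errorRow x y h = η) (i : Fin m) :
    signed (h (x i)) = signed (y i) * (1 - 2 * entry η i) := by
  subst hη
  unfold signed entry errorRow
  cases h (x i) <;> cases y i <;> norm_num

/-- Along almost every orbit of an invariant measure, the averages of `α_t` weighted by a function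
of the selected row converge. -/
theorem ae_exists_tendsto_average (hM : M.Nonempty) (hsel : ∀ s ⊆ M, s.Nonempty → sel s ∈ s)
    {μ : Measure (Simplex m)} [IsFiniteMeasure μ] (hμ : IsInvariant M sel μ) (φ : Row m → ℝ) :
    ∀ᵐ w₁ ∂μ, ∃ L : ℝ, Tendsto (fun T : ℕ => 1 / (T : ℝ) * ∑ t ∈ Finset.Icc 1 T,
      alpha M (weight M sel w₁ t) * φ (best M sel (weight M sel w₁ t))) atTop (𝓝 L) := by
  obtain ⟨B, hB⟩ := (Set.finite_range fun η => |φ η|).bddAbove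
  have hgm : Measurable fun w => alpha M w * φ (best M sel w) :=
    measurable_alpha.mul (measurable_comp_best fun η => measurable_const)
  have hbd : ∀ᵐ w ∂μ, |alpha M w * φ (best M sel w)| ≤
      1 / 2 * Real.log (2 ^ Fintype.card (Row m)) * B := by
    filter_upwards [ae_abs_alpha_le hM hsel hμ] with w hw
    rw [abs_mul]
    exact mul_le_mul hw (hB ⟨_, rfl⟩) (abs_nonneg _) ((abs_nonneg _).trans hw)
  filter_upwards [ae_exists_tendsto_birkhoffAverage hμ.2 hgm hbd] with w ⟨L, hL⟩
  refine ⟨L, hL.congr fun T => ?_⟩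
  -- Rounds are counted from 1 and iterates from 0.
  rw [birkhoffAverage, birkhoffSum, smul_eq_mul, one_div, Finset.range_eq_Ico,
    ← Finset.Ico_add_one_right_eq_Icc, Finset.sum_Ico_eq_sum_range, Finset.sum_Ico_eq_sum_range]
  simp [weight]

end AdaBoost

end

theorem theoremT {X : Type*} {m : ℕ} (H : Set (X → Bool)) (hH : H.Nonempty)
    (x : Fin m → X) (y : Fin m → Bool)
    (sel : Set (AdaBoost.Row m) → AdaBoost.Row m)
    (hsel : ∀ s ⊆ AdaBoost.errorMatrix H x y, s.Nonempty → sel s ∈ s)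
    (hNT : AdaBoost.NoTies (AdaBoost.errorMatrix H x y) sel) :
    ((AdaBoost.Omega (AdaBoost.errorMatrix H x y) sel).Nonempty →
      ∃ μ : Measure (AdaBoost.Simplex m), IsProbabilityMeasure μ ∧
        AdaBoost.IsInvariant (AdaBoost.errorMatrix H x y) sel μ) ∧
    ∀ μ : Measure (AdaBoost.Simplex m), IsProbabilityMeasure μ →
      AdaBoost.IsInvariant (AdaBoost.errorMatrix H x y) sel μ →
      ∀ᵐ w₁ ∂μ, ∀ i : Fin m,
        (∃ L : ℝ, Tendsto (fun T : ℕ =>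
          1 / (T : ℝ) * AdaBoost.F (AdaBoost.errorMatrix H x y) sel w₁ T i) atTop (𝓝 L)) ∧
        ∀ h : ℕ → X → Bool,
          (∀ t ≥ 1, h t ∈ H ∧ AdaBoost.errorRow x y (h t) =
            AdaBoost.best (AdaBoost.errorMatrix H x y) sel
              (AdaBoost.weight (AdaBoost.errorMatrix H x y) sel w₁ t)) →
          ∃ L : ℝ, Tendsto (fun T : ℕ =>
            1 / (T : ℝ) * AdaBoost.classifier (AdaBoost.errorMatrix H x y) sel w₁ h T (x i))
            atTop (𝓝 L) := by
  have hM : (AdaBoost.errorMatrix H x y).Nonempty := hH.image _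
  refine ⟨AdaBoost.exists_isInvariant hM hsel hNT, fun μ _ hμ => ?_⟩
  refine ae_all_iff.2 fun i => ?_
  filter_upwards [AdaBoost.ae_exists_tendsto_average hM hsel hμ fun η =>
      2 * (AdaBoost.entry η i - 1),
    AdaBoost.ae_exists_tendsto_average hM hsel hμ fun η =>
      AdaBoost.signed (y i) * (1 - 2 * AdaBoost.entry η i)] with w ⟨L₁, h₁⟩ ⟨L₂, h₂⟩
  refine ⟨⟨L₁, h₁.congr fun T => ?_⟩, fun h hh => ⟨L₂, h₂.congr fun T => ?_⟩⟩
  · unfold AdaBoost.F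
    congr 1
    exact Finset.sum_congr rfl fun t _ => by ring
  · unfold AdaBoost.classifier
    congr 1
    refine Finset.sum_congr rfl fun t ht => ?_
    rw [AdaBoost.signed_eq_of_errorRow (hh t (Finset.mem_Icc.1 ht).1).2]
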